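/- Let $\varphi=(\varphi_e)_{e\in\mathbb N}$ be any acceptable programming system for the partial computable functions $\mathbb N\to\mathbb N$, and let $W_e=\mathrm{dom}(\varphi_e)$. A language is a computably enumerable set $L\subseteq\mathbb N$. A text is a total function $T:\mathbb N\to\mathbb N\cup\{\#\}$, where $\#$ denotes a pause; $T[i]$ denotes the sequence $T(0),\dots,T(i-1)$, and $\mathrm{content}(\cdot)$ denotes the set of all entries other than $\#$ of a text or finite sequence. $T$ is a text for $L$ if $\mathrm{content}(T)=L$. A learner is a partial computable function $h$ from finite sequences over $\mathbb N\cup\{\#\}$ to $\mathbb N$; on a text $T$ it yields the hypotheses $p(i)=h(T[i])$, $i\in\mathbb N$. Consider the following restrictions on a total sequence $p$ of hypotheses and a text $T$ (where $\subset$ is proper inclusion): - $\mathbf{Ex}$: there is $n_0$ such that for all $n\ge n_0$, $p(n)=p(n_0)$ and $W_{p(n_0)}=\mathrm{content}(T)$; - $\mathbf{Caut}$ (cautious): for all $i,j$, if $W_{p(i)}\subset W_{p(j)}$ then $i<j$; - $\mathbf{Conv}$ (conservative): for all $i$, if $\mathrm{content}(T[i+1])\subseteq W_{p(i)}$ then $p(i)=p(i+1)$;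 - $\mathbf{SDec}$ (strongly decisive): for all $i\le j\le k$, if $W_{p(i)}=W_{p(k)}$ then $p(j)=p(i)$; - $\mathbf{Mon}$ (monotone): for all $i<j$, $W_{p(i)}\cap\mathrm{content}(T)\subseteq W_{p(j)}\cap\mathrm{content}(T)$. Juxtaposition of restrictions means their conjunction. For a restriction $\delta$, a class $\mathcal L$ of languages is $\mathbf{TxtG}\delta$-learnable if there is one learner $h$ such that, for every $L\in\mathcal L$ and every text $T$ for $L$, the sequence $p$ of hypotheses of $h$ on $T$ is total and satisfies $\delta$ together with $T$; $[\mathbf{TxtG}\delta]$ denotes the set of all $\mathbf{TxtG}\delta$-learnable classes of languages. **Theorem.** There is a class of languages that is $\mathbf{TxtGSDecMonEx}$-learnable but not $\mathbf{TxtGCautEx}$-learnable. Moreover, cautious learning is equivalent to conservative learning and strictly weaker than strongly decisive learning: $$[\mathbf{TxtGCautEx}]=[\mathbf{TxtGConvEx}]\qquad\text{and}\qquad[\mathbf{TxtGCautEx}]\subset[\mathbf{TxtGSDecEx}].$$ -/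

import Mathlib

namespace TxtLearning

/-- An acceptable programming system for the partial computable functions `ℕ → ℕ`
(`φ e` is the function computed by program `e`): it is uniformly partial computable, and programs
of any other uniformly partial computable system can be computably translated into it. In
particular every partial computable function is some `φ e`. -/
structure IsAcceptable (φ : ℕ → ℕ →. ℕ) : Prop where
  partrec : Partrec₂ φ
  translate : ∀ ψ : ℕ → ℕ →. ℕ, Partrec₂ ψ → ∃ s : ℕ → ℕ, Computable s ∧ ∀ e, φ (s e) = ψ e

/-- `W φ e` is the domain of the function computed by program `e`. -/
def W (φ : ℕ → ℕ →. ℕ) (e : ℕ) : Set ℕ := (φ e).Dom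

/-- A text; `none` is the pause symbol `#`. -/
abbrev Text := ℕ → Option ℕ

/-- The data of a finite sequence: its entries other than the pause. -/
def seqContent (σ : List (Option ℕ)) : Set ℕ := {x | some x ∈ σ}

/-- The data of a text: its values other than the pause. -/
def Text.content (T : Text) : Set ℕ := {x | ∃ i, T i = some x}

/-- The initial segment `T 0, …, T (i - 1)`. -/
def Text.take (T : Text) (i : ℕ) : List (Option ℕ) := (List.range i).map T

/-- The learning sequence in full-information (Gold-style) learning: the `i`-th hypothesis is the
output (if any) of the learner `h` on the first `i` entries of the text. -/
def gold (h : List (Option ℕ) →. ℕ) (T : Text) : ℕ →. ℕ := fun i => h (T.take i)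

/-- A learning restriction: a predicate on (total) sequences of hypotheses and texts. The
conjunction of two restrictions is `δ ⊓ δ'`. -/
abbrev Restriction := (ℕ → ℕ) → Text → Prop

section Restrictions

variable (φ : ℕ → ℕ →. ℕ)

/-- Explanatory learning. -/
def Ex : Restriction := fun p T =>
  ∃ n₀, ∀ n, n₀ ≤ n → p n = p n₀ ∧ W φ (p n₀) = T.content

/-- Conservative learning. -/
def Conv : Restriction := fun p T =>
  ∀ i, seqContent (T.take (i + 1)) ⊆ W φ (p i) → p i = p (i + 1)

/-- Cautious learning (`⊂` is proper inclusion). -/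
def Caut : Restriction := fun p _ =>
  ∀ i j, W φ (p i) ⊂ W φ (p j) → i < j

/-- Strongly decisive learning. -/
def SDec : Restriction := fun p _ =>
  ∀ i j k, i ≤ j → j ≤ k → W φ (p i) = W φ (p k) → p j = p i

/-- Monotone learning. -/
def Mon : Restriction := fun p T =>
  ∀ i j, i < j → W φ (p i) ∩ T.content ⊆ W φ (p j) ∩ T.content

end Restrictions

/-- `h` learns the language `L` under the restriction `δ`: on every text for `L`, the learning
sequence of `h` is total and satisfies `δ`. -/
def Learns (δ : Restriction) (h : List (Option ℕ) →. ℕ) (L : Set ℕ) : Prop :=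
  ∀ T : Text, T.content = L → ∃ p : ℕ → ℕ, (∀ i, p i ∈ gold h T i) ∧ δ p T

/-- `TxtG δ` is the set of all classes of languages (computably enumerable sets) all of whose
members are learned under `δ` by one and the same partial computable Gold-style learner. -/
def TxtG (δ : Restriction) : Set (Set (Set ℕ)) :=
  {𝓛 | (∀ L ∈ 𝓛, REPred (fun x => x ∈ L)) ∧
    ∃ h : List (Option ℕ) →. ℕ, Partrec h ∧ ∀ L ∈ 𝓛, Learns δ h L}

end TxtLearning

open TxtLearning

/-! Both comparisons of learning criteria pass through target-cautious learning `CautTar`, which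
forbids only hypotheses properly containing the target. `Ex` together with either `Caut` or `Conv`
implies it, and `TxtG_cautTar_subset` turns a target-cautious learner `h` into one that is
conservative, cautious and strongly decisive at once.

The new learner keeps a sequence `σ` with hypothesis `c` of `h`, and conjectures `guarded v e σ c`:
the data of `σ` together with the `c`-th set, enumerated only until some `τ` with data in that set
is seen to change the mind of `h` after `σ`. When such a `τ` occurs within the current data `D`, and
`D` is not confirmed to lie in the guarded set, `σ` is extended by `τ` and `D`. In that case `D`
really is not contained in the guarded set, so every later, different conjecture contains a datum
missing from it; all three restrictions follow. Infinitely many revisions would spell out a text for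
the target on which `h` changes its mind forever. Once `σ` is final, either no data of the target
can change the mind of `h`, and `c` is correct; or all data gets confirmed, the guarded set contains
the target, and target-caution rules out a proper superset.

For the separation, the `e`-th row of `rowClass` diagonalizes against the learner with program `e`;
as `e` is coded into the data, no recursion theorem is needed. The row is cut off after entry `n` if
the least witness shows program `e` conjecturing a set that already contains entry `n + 1`. So
program `e` either overgeneralizes or never reaches the full row. A learner allowed to
overgeneralize conjectures the empty set, then `openRow`, then `closedRow` once the least witness is
found. -/

namespace TxtLearning

open Encodable
open Nat.Partrec (Code)

/-! ### Step-bounded computations -/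

section BoundedQuantifiers

variable {α β : Type*} [Primcodable α] [Primcodable β] {R : ℕ → β → Prop}

theorem primrecPred_exists_lt (hR : PrimrecRel R) {f : α → ℕ} {g : α → β} (hf : Primrec f)
    (hg : Primrec g) : PrimrecPred fun a => ∃ k < f a, R k (g a) :=
  (hR.exists_mem_list.comp (Primrec.list_range.comp hf) hg).of_eq (by simp)

theorem primrecPred_forall_lt (hR : PrimrecRel R) {f : α → ℕ} {g : α → β} (hf : Primrec f)
    (hg : Primrec g) : PrimrecPred fun a => ∀ k < f a, R k (g a) :=
  (hR.forall_mem_list.comp (Primrec.list_range.comp hf) hg).of_eq (by simp)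

end BoundedQuantifiers

/-- The output of program `e` on input `n` if it is reached within `t` steps. -/
def runs (e t n : ℕ) : Option ℕ := Code.evaln t (Denumerable.ofNat Code e) n

theorem primrec_runs {α : Type*} [Primcodable α] {f g h : α → ℕ} (hf : Primrec f) (hg : Primrec g)
    (hh : Primrec h) : Primrec fun a => runs (f a) (g a) (h a) :=
  Code.primrec_evaln.comp ((hg.pair ((Primrec.ofNat Code).comp hf)).pair hh)

theorem runs_mono {e t t' n b : ℕ} (h : t ≤ t') (hb : runs e t n = some b) :
    runs e t' n = some b :=
  Code.evaln_mono h hb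

theorem exists_index {α : Type*} [Primcodable α] {f : α →. ℕ} (hf : Partrec f) :
    ∃ e, ∀ a b, b ∈ f a ↔ ∃ t, runs e t (encode a) = some b := by
  obtain ⟨c, hc⟩ := Code.exists_code.1 hf
  refine ⟨encode c, fun a b => ?_⟩
  have h1 : b ∈ f a ↔ b ∈ c.eval (encode a) := by
    rw [hc]
    simp
  rw [h1, Code.evaln_complete]
  simp [runs]

/-- `enumerated v c t x`: the element `x` is listed in the `c`-th set by stage `t`, where `v` is a
program for the numbering. -/
def enumerated (v c t x : ℕ) : Prop := (runs v t (encode (c, x))).isSome = true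

theorem enumerated.mono {v c t t' x : ℕ} (h : t ≤ t') (hx : enumerated v c t x) :
    enumerated v c t' x := by
  obtain ⟨b, hb⟩ := Option.isSome_iff_exists.1 hx
  exact Option.isSome_iff_exists.2 ⟨b, runs_mono h hb⟩

theorem primrec_enumerated {α : Type*} [Primcodable α] (v : ℕ) {f g h : α → ℕ} (hf : Primrec f)
    (hg : Primrec g) (hh : Primrec h) : PrimrecPred fun a => enumerated v (f a) (g a) (h a) :=
  Primrec.eq.comp
    (Primrec.option_isSome.comp (primrec_runs (Primrec.const v) hg
      (Primrec.encode.comp (hf.pair hh)))) (Primrec.const true)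

/-- A single program `v` for the universal function supplies decidable stages of all the sets at
once. -/
theorem IsAcceptable.exists_enumerated {φ : ℕ → ℕ →. ℕ} (hφ : IsAcceptable φ) :
    ∃ v, ∀ c x, x ∈ W φ c ↔ ∃ t, enumerated v c t x := by
  obtain ⟨v, hv⟩ := exists_index (f := fun p : ℕ × ℕ => φ p.1 p.2) hφ.partrec
  refine ⟨v, fun c x => ?_⟩
  change (φ c x).Dom ↔ _
  rw [Part.dom_iff_mem]
  constructor
  · rintro ⟨b, hb⟩
    obtain ⟨t, ht⟩ := (hv (c, x) b).1 hb
    exact ⟨t, Option.isSome_iff_exists.2 ⟨b, ht⟩⟩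
  · rintro ⟨t, ht⟩
    obtain ⟨b, hb⟩ := Option.isSome_iff_exists.1 ht
    exact ⟨b, (hv (c, x) b).2 ⟨t, hb⟩⟩

/-- A uniformly enumerable family of sets has a computable translation into an acceptable
programming system. -/
theorem IsAcceptable.exists_program {φ : ℕ → ℕ →. ℕ} (hφ : IsAcceptable φ) {α : Type*}
    [Primcodable α] {R : α → ℕ → ℕ → Prop}
    (hR : PrimrecPred fun p : (α × ℕ) × ℕ => R p.1.1 p.1.2 p.2) :
    ∃ s : α → ℕ, Computable s ∧ ∀ a, W φ (s a) = {x | ∃ t, R a x t} := by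
  classical
  obtain ⟨_, hR⟩ := hR
  let ψ : ℕ → ℕ →. ℕ := fun n x => ((decode (α := α) n : Option α) : Part α).bind fun a =>
    Nat.rfind fun t => Part.some (decide (R a x t))
  have hψ : Partrec₂ ψ := by
    refine Partrec.bind (Computable.ofOption (Computable.decode.comp Computable.fst)) ?_
    have hg : Computable fun p : ((ℕ × ℕ) × α) × ℕ => ((p.1.2, p.1.1.2), p.2) :=
      ((Computable.snd.comp Computable.fst).pair
        (Computable.snd.comp (Computable.fst.comp Computable.fst))).pair Computable.snd
    have h2 : Computable fun p : ((ℕ × ℕ) × α) × ℕ => decide (R p.1.2 p.1.1.2 p.2) :=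
      (hR.to_comp.comp hg).of_eq fun p => by congr
    exact Partrec.rfind (p := fun (q : (ℕ × ℕ) × α) t => Part.some (decide (R q.2 q.1.2 t)))
      h2.partrec
  obtain ⟨s, hs, hs'⟩ := hφ.translate ψ hψ
  refine ⟨fun a => s (encode a), hs.comp Computable.encode, fun a => ?_⟩
  ext x
  change (φ (s (encode a)) x).Dom ↔ _
  rw [hs']
  have h1 : ψ (encode a) x = Nat.rfind fun t => Part.some (decide (R a x t)) := by
    simp [ψ]
  rw [h1]
  refine Nat.rfind_dom.trans ?_
  simp

/-! ### Texts -/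

theorem seqContent_append (σ τ : List (Option ℕ)) :
    seqContent (σ ++ τ) = seqContent σ ∪ seqContent τ := by
  ext x; simp [seqContent]

theorem Text.length_take (T : Text) (i : ℕ) : (T.take i).length = i := by simp [Text.take]

theorem Text.mem_take {T : Text} {i : ℕ} {o : Option ℕ} : o ∈ T.take i ↔ ∃ j < i, T j = o := by
  simp [Text.take]

theorem Text.list_take_take (T : Text) {i j : ℕ} (h : i ≤ j) : (T.take j).take i = T.take i := by
  simp [Text.take, ← List.map_take, List.take_range, h]

theorem Text.seqContent_take_mono (T : Text) {i j : ℕ} (h : i ≤ j) :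
    seqContent (T.take i) ⊆ seqContent (T.take j) := by
  intro x hx
  obtain ⟨k, hk, hx⟩ := Text.mem_take.1 hx
  exact Text.mem_take.2 ⟨k, hk.trans_le h, hx⟩

theorem Text.seqContent_take_subset (T : Text) (i : ℕ) : seqContent (T.take i) ⊆ T.content := by
  intro x hx
  obtain ⟨k, -, hx⟩ := Text.mem_take.1 hx
  exact ⟨k, hx⟩

theorem Text.exists_mem_take {T : Text} {x : ℕ} (hx : x ∈ T.content) :
    ∃ n, ∀ i, n ≤ i → x ∈ seqContent (T.take i) := by
  obtain ⟨k, hk⟩ := hx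
  exact ⟨k + 1, fun i hi => Text.mem_take.2 ⟨k, hi, hk⟩⟩

/-- The text that starts with `σ` and continues with `T`. -/
def Text.prepend (σ : List (Option ℕ)) (T : Text) : Text := fun n =>
  if h : n < σ.length then σ[n] else T (n - σ.length)

theorem Text.take_prepend (σ : List (Option ℕ)) (T : Text) (n : ℕ) :
    (T.prepend σ).take (σ.length + n) = σ ++ T.take n := by
  apply List.ext_getElem
  · simp [Text.take]
  · intro i h1 h2
    simp [Text.take, Text.prepend, List.getElem_append]

theorem Text.content_prepend (σ : List (Option ℕ)) (T : Text) :
    (T.prepend σ).content = seqContent σ ∪ T.content := by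
  ext x
  constructor
  · rintro ⟨i, hi⟩
    have : x ∈ seqContent ((T.prepend σ).take (σ.length + (i + 1))) :=
      Text.mem_take.2 ⟨i, by omega, hi⟩
    rw [Text.take_prepend, seqContent_append] at this
    exact this.imp_right fun h => T.seqContent_take_subset _ h
  · intro hx
    have : ∃ n, x ∈ seqContent (σ ++ T.take n) := by
      rcases hx with hx | hx
      · exact ⟨0, by rw [seqContent_append]; exact Or.inl hx⟩
      · obtain ⟨n, hn⟩ := Text.exists_mem_take hx
        exact ⟨n, by rw [seqContent_append]; exact Or.inr (hn n le_rfl)⟩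
    obtain ⟨n, hn⟩ := this
    rw [← Text.take_prepend] at hn
    exact Text.seqContent_take_subset _ _ hn

theorem exists_text (L : Set ℕ) : ∃ T : Text, T.content = L := by
  classical
  refine ⟨fun i => if i ∈ L then some i else none, ?_⟩
  ext x
  simp [Text.content]

/-! ### Comparing restrictions -/

/-- Target-cautious learning: no hypothesis is a proper superset of the target. -/
def CautTar (φ : ℕ → ℕ →. ℕ) : Restriction := fun p T => ∀ i, ¬ T.content ⊂ W φ (p i)

/-- At position `max i n₀` the hypothesis is correct, and caution would force this position to come
before `i`. -/
theorem Caut.cautTar {φ : ℕ → ℕ →. ℕ} {p : ℕ → ℕ} {T : Text} (hc : Caut φ p T) (he : Ex φ p T) :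
    CautTar φ p T := by
  intro i hi
  obtain ⟨n₀, hn⟩ := he
  have h := hn (max i n₀) (le_max_right _ _)
  have := hc (max i n₀) i (by rw [h.1, h.2]; exact hi)
  omega

/-- A hypothesis containing all of the target is never contradicted by data, so a conservative
learner keeps it forever and its limit is wrong. -/
theorem Conv.cautTar {φ : ℕ → ℕ →. ℕ} {p : ℕ → ℕ} {T : Text} (hc : Conv φ p T) (he : Ex φ p T) :
    CautTar φ p T := by
  intro i hi
  have hconst : ∀ k, p (i + k) = p i := by
    intro k
    induction k with
    | zero => rfl
    | succ k ih =>
      rw [← ih]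
      refine (hc (i + k) ?_).symm
      rw [ih]
      exact (T.seqContent_take_subset _).trans hi.subset
  obtain ⟨n₀, hn⟩ := he
  have h1 := hn (i + n₀) (by omega)
  rw [hconst] at h1
  rw [h1.1, h1.2] at hi
  exact hi.ne rfl

theorem Learns.mono {δ δ' : Restriction} {h : List (Option ℕ) →. ℕ} {L : Set ℕ}
    (hL : Learns δ h L) (hδ : ∀ p T, δ p T → δ' p T) : Learns δ' h L := by
  intro T hT
  obtain ⟨p, hp, hd⟩ := hL T hT
  exact ⟨p, hp, hδ p T hd⟩

theorem TxtG_mono {δ δ' : Restriction} (hδ : ∀ p T, δ p T → δ' p T) : TxtG δ ⊆ TxtG δ' := by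
  rintro 𝓛 ⟨hre, h, hh, hl⟩
  exact ⟨hre, h, hh, fun L hL => (hl L hL).mono hδ⟩

theorem IsAcceptable.rePred_W {φ : ℕ → ℕ →. ℕ} (hφ : IsAcceptable φ) (c : ℕ) :
    REPred fun x => x ∈ W φ c :=
  (hφ.partrec.comp (Computable.const c) Computable.id).dom_re

/-- Every language that is learned explanatorily is computably enumerable. -/
theorem Learns.rePred {φ : ℕ → ℕ →. ℕ} (hφ : IsAcceptable φ) {δ : Restriction}
    {h : List (Option ℕ) →. ℕ} {L : Set ℕ} (hL : Learns δ h L) (hδ : ∀ p T, δ p T → Ex φ p T) :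
    REPred fun x => x ∈ L := by
  obtain ⟨T, hT⟩ := exists_text L
  obtain ⟨p, -, hd⟩ := hL T hT
  obtain ⟨n₀, hn⟩ := hδ p T hd
  rw [← hT, ← (hn n₀ le_rfl).2]
  exact hφ.rePred_W _

/-! ### Target-cautious learners can be made conservative, cautious and strongly decisive -/

/-- All data of `σ` is listed in the `c`-th set by stage `t`. -/
def Covered (v c t : ℕ) (σ : List (Option ℕ)) : Prop :=
  ∀ o ∈ σ, o = none ∨ enumerated v c t (o.getD 0)

/-- Within `t` steps, program `e` is seen to change its hypothesis `c` between `σ` and `σ ++ τ`. -/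
def Changes (e c t : ℕ) (σ τ : List (Option ℕ)) : Prop :=
  (runs e t (encode (σ ++ τ))).getD c ≠ c

/-- The finite sequence with code `k`. -/
def seqOfCode (k : ℕ) : List (Option ℕ) := (decode k : Option (List (Option ℕ))).getD []

/-- By stage `t`, the sequence `σ` is consistent with the hypothesis `c` and looks like a locking
sequence for it. -/
def Passes (v e : ℕ) (σ : List (Option ℕ)) (c t : ℕ) : Prop :=
  Covered v c t σ ∧
    ∀ k < t, ¬ (Covered v c t (seqOfCode k) ∧ Changes e c t σ (seqOfCode k))

/-- The `c`-th set, enumerated only as long as `σ` looks like a locking sequence for it. -/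
def guarded (v e : ℕ) (σ : List (Option ℕ)) (c : ℕ) : Set ℕ :=
  {x | ∃ t, some x ∈ σ ∨ (Passes v e σ c t ∧ enumerated v c t x)}

/-- The data `D` is seen to be contained in `guarded v e σ c`. -/
def Confirmed (v e : ℕ) (σ : List (Option ℕ)) (c : ℕ) (D : List (Option ℕ)) : Prop :=
  (∀ o ∈ D, o ∈ none :: σ) ∨ ∃ t < D.length + 1, Passes v e σ c t ∧ Covered v c t D

/-- The sequence that is examined when the data `D` is present. -/
def challenge (D : List (Option ℕ)) : List (Option ℕ) := seqOfCode D.length.unpair.1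

/-- On data `D`, the challenge shows that `σ` is not locking, and the data is not yet confirmed. -/
def Revises (v e : ℕ) (σ : List (Option ℕ)) (c : ℕ) (D : List (Option ℕ)) : Prop :=
  (∀ o ∈ challenge D, o ∈ none :: D) ∧ Changes e c D.length σ (challenge D) ∧
    ¬ Confirmed v e σ c D

/-! ### Decidability of the stage-bounded predicates -/

theorem primrecPred_covered {α : Type*} [Primcodable α] (v : ℕ) {f g : α → ℕ}
    {h : α → List (Option ℕ)} (hf : Primrec f) (hg : Primrec g) (hh : Primrec h) :
    PrimrecPred fun a => Covered v (f a) (g a) (h a) := by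
  have h1 : PrimrecRel fun (o : Option ℕ) (p : ℕ × ℕ) =>
      o = none ∨ enumerated v p.1 p.2 (o.getD 0) := by
    refine PrimrecPred.or (Primrec.eq.comp Primrec.fst (Primrec.const none)) ?_
    exact primrec_enumerated v (Primrec.fst.comp Primrec.snd) (Primrec.snd.comp Primrec.snd)
      (Primrec.option_getD.comp Primrec.fst (Primrec.const 0))
  exact h1.forall_mem_list.comp hh (hf.pair hg)

theorem primrecPred_changes {α : Type*} [Primcodable α] (e : ℕ) {f g : α → ℕ}
    {h k : α → List (Option ℕ)} (hf : Primrec f) (hg : Primrec g) (hh : Primrec h)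
    (hk : Primrec k) : PrimrecPred fun a => Changes e (f a) (g a) (h a) (k a) :=
  (Primrec.eq.comp (Primrec.option_getD.comp (primrec_runs (Primrec.const e) hg
    (Primrec.encode.comp (Primrec.list_append.comp hh hk))) hf) hf).not

theorem primrec_seqOfCode : Primrec seqOfCode :=
  Primrec.option_getD.comp Primrec.decode (Primrec.const [])

theorem primrecPred_passes {α : Type*} [Primcodable α] (v e : ℕ) {f g : α → ℕ}
    {h : α → List (Option ℕ)} (hh : Primrec h) (hf : Primrec f) (hg : Primrec g) :
    PrimrecPred fun a => Passes v e (h a) (f a) (g a) := by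
  have h1 : PrimrecRel fun (k : ℕ) (p : List (Option ℕ) × ℕ × ℕ) =>
      ¬ (Covered v p.2.1 p.2.2 (seqOfCode k) ∧ Changes e p.2.1 p.2.2 p.1 (seqOfCode k)) := by
    have hc : Primrec fun q : ℕ × List (Option ℕ) × ℕ × ℕ => q.2.2.1 :=
      Primrec.fst.comp (Primrec.snd.comp Primrec.snd)
    have ht : Primrec fun q : ℕ × List (Option ℕ) × ℕ × ℕ => q.2.2.2 :=
      Primrec.snd.comp (Primrec.snd.comp Primrec.snd)
    have hs : Primrec fun q : ℕ × List (Option ℕ) × ℕ × ℕ => seqOfCode q.1 :=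
      primrec_seqOfCode.comp Primrec.fst
    exact ((primrecPred_covered v hc ht hs).and
      (primrecPred_changes e hc ht (Primrec.fst.comp Primrec.snd) hs)).not
  have h2 := primrecPred_forall_lt h1 hg (hh.pair (hf.pair hg))
  exact (primrecPred_covered v hf hg hh).and h2

theorem primrecPred_confirmed (v e : ℕ) :
    PrimrecPred fun p : (List (Option ℕ) × ℕ) × List (Option ℕ) =>
      Confirmed v e p.1.1 p.1.2 p.2 := by
  have hmem : PrimrecRel fun (o : Option ℕ) (σ : List (Option ℕ)) => o ∈ none :: σ := by
    have := (Primrec.eq (α := Option ℕ)).exists_mem_list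
    exact (this.comp (Primrec.list_cons.comp (Primrec.const none) Primrec.snd)
      Primrec.fst).of_eq fun p => by simp
  have hsub : PrimrecPred fun p : (List (Option ℕ) × ℕ) × List (Option ℕ) =>
      ∀ o ∈ p.2, o ∈ none :: p.1.1 :=
    hmem.forall_mem_list.comp Primrec.snd (Primrec.fst.comp Primrec.fst)
  have h1 : PrimrecRel fun (t : ℕ) (p : (List (Option ℕ) × ℕ) × List (Option ℕ)) =>
      Passes v e p.1.1 p.1.2 t ∧ Covered v p.1.2 t p.2 := by
    have hc : Primrec fun q : ℕ × (List (Option ℕ) × ℕ) × List (Option ℕ) => q.2.1.2 :=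
      Primrec.snd.comp (Primrec.fst.comp Primrec.snd)
    exact (primrecPred_passes v e (Primrec.fst.comp (Primrec.fst.comp Primrec.snd)) hc
      Primrec.fst).and (primrecPred_covered v hc Primrec.fst (Primrec.snd.comp Primrec.snd))
  have h2 := primrecPred_exists_lt h1 (Primrec.succ.comp (Primrec.list_length.comp Primrec.snd))
    Primrec.id
  exact hsub.or h2

theorem primrec_challenge : Primrec challenge :=
  primrec_seqOfCode.comp (Primrec.fst.comp (Primrec.unpair.comp Primrec.list_length))

theorem primrecPred_revises (v e : ℕ) :
    PrimrecPred fun p : (List (Option ℕ) × ℕ) × List (Option ℕ) =>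
      Revises v e p.1.1 p.1.2 p.2 := by
  have hmem : PrimrecRel fun (o : Option ℕ) (σ : List (Option ℕ)) => o ∈ none :: σ := by
    have := (Primrec.eq (α := Option ℕ)).exists_mem_list
    exact (this.comp (Primrec.list_cons.comp (Primrec.const none) Primrec.snd)
      Primrec.fst).of_eq fun p => by simp
  have hch : Primrec fun p : (List (Option ℕ) × ℕ) × List (Option ℕ) => challenge p.2 :=
    primrec_challenge.comp Primrec.snd
  exact (hmem.forall_mem_list.comp hch Primrec.snd).and
    ((primrecPred_changes e (Primrec.snd.comp Primrec.fst) (Primrec.list_length.comp Primrec.snd)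
      (Primrec.fst.comp Primrec.fst) hch).and (primrecPred_confirmed v e).not)

/-! ### Data contained in guarded sets -/

theorem covered_iff {v c t : ℕ} {σ : List (Option ℕ)} :
    Covered v c t σ ↔ ∀ x ∈ seqContent σ, enumerated v c t x := by
  constructor
  · intro h x hx
    simpa using h _ hx
  · intro h o ho
    cases o with
    | none => exact Or.inl rfl
    | some x => exact Or.inr (h x ho)

theorem seqContent_subset_iff {σ τ : List (Option ℕ)} :
    seqContent τ ⊆ seqContent σ ↔ ∀ o ∈ τ, o ∈ none :: σ := by
  constructor
  · intro h o ho
    cases o with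
    | none => simp
    | some x => exact List.mem_cons_of_mem _ (h ho)
  · intro h x hx
    exact (List.mem_cons.1 (h _ hx)).resolve_left (by simp)

theorem changes_iff {e c t : ℕ} {σ τ : List (Option ℕ)} :
    Changes e c t σ τ ↔ ∃ c', runs e t (encode (σ ++ τ)) = some c' ∧ c' ≠ c := by
  unfold Changes
  cases runs e t (encode (σ ++ τ)) <;> simp

theorem Changes.mono {e c t t' : ℕ} {σ τ : List (Option ℕ)} (h : t ≤ t')
    (hc : Changes e c t σ τ) : Changes e c t' σ τ := by
  obtain ⟨c', h1, h2⟩ := changes_iff.1 hc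
  exact changes_iff.2 ⟨c', runs_mono h h1, h2⟩

theorem seqOfCode_encode (τ : List (Option ℕ)) : seqOfCode (encode τ) = τ := by
  simp [seqOfCode]

/-- Finitely many elements satisfying an eventual property satisfy it at a common stage. -/
theorem exists_stage {P : ℕ → ℕ → Prop} (hP : ∀ x t t', t ≤ t' → P x t → P x t')
    (σ : List (Option ℕ)) (h : ∀ x ∈ seqContent σ, ∃ t, P x t) :
    ∃ t, ∀ x ∈ seqContent σ, P x t := by
  induction σ with
  | nil => exact ⟨0, fun x hx => by simp [seqContent] at hx⟩
  | cons o σ ih =>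
    obtain ⟨t, ht⟩ := ih fun x hx => h x (List.mem_cons_of_mem _ hx)
    cases o with
    | none =>
      refine ⟨t, fun x hx => ht x ?_⟩
      simpa [seqContent] using hx
    | some y =>
      obtain ⟨t', ht'⟩ := h y (by simp [seqContent])
      refine ⟨max t t', fun x hx => ?_⟩
      rcases List.mem_cons.1 hx with hx | hx
      · cases hx
        exact hP _ _ _ (le_max_right _ _) ht'
      · exact hP _ _ _ (le_max_left _ _) (ht x hx)

theorem seqContent_subset_guarded (v e : ℕ) (σ : List (Option ℕ)) (c : ℕ) :
    seqContent σ ⊆ guarded v e σ c := fun _ hx => ⟨0, Or.inl hx⟩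

/-- Data found at different passing stages can be collected at one of them: coverage persists, so
the latest passing stage serves for all. The data of `σ` itself is covered at every passing stage.
-/
theorem subset_guarded_iff {v e c : ℕ} {σ D : List (Option ℕ)} :
    seqContent D ⊆ guarded v e σ c ↔
      seqContent D ⊆ seqContent σ ∨ ∃ t, Passes v e σ c t ∧ Covered v c t D := by
  constructor
  · intro h
    induction D with
    | nil => exact Or.inl fun x hx => by simp [seqContent] at hx
    | cons o D ih =>
      have hD : seqContent D ⊆ guarded v e σ c := fun x hx => h (List.mem_cons_of_mem _ hx)
      cases o with
      | none => simpa [seqContent, Covered] using ih hD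
      | some y =>
        have key : ∀ t, Passes v e σ c t → enumerated v c t y → Covered v c t D →
            Covered v c t (some y :: D) := by
          intro t _ hy hc o ho
          rcases List.mem_cons.1 ho with rfl | ho
          · exact Or.inr hy
          · exact hc o ho
        obtain ⟨t, hy⟩ := h (show y ∈ seqContent (some y :: D) by simp [seqContent])
        rcases ih hD with hs | ⟨t', hp, hc⟩
        · rcases hy with hy | ⟨hp, hy⟩
          · refine Or.inl fun x hx => ?_
            rcases List.mem_cons.1 hx with hx | hx
            · cases hx
              exact hy
            · exact hs hx
          · exact Or.inr ⟨t, hp, key t hp hy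
              (covered_iff.2 fun x hx => covered_iff.1 hp.1 x (hs hx))⟩
        · rcases hy with hy | ⟨hp', hy⟩
          · exact Or.inr ⟨t', hp, key t' hp (covered_iff.1 hp.1 y hy) hc⟩
          · rcases le_total t t' with htt | htt
            · exact Or.inr ⟨t', hp, key t' hp (hy.mono htt) hc⟩
            · exact Or.inr ⟨t, hp', key t hp' hy
                (covered_iff.2 fun x hx => (covered_iff.1 hc x hx).mono htt)⟩
  · rintro (h | ⟨t, hp, hc⟩) x hx
    · exact ⟨0, Or.inl (h hx)⟩
    · exact ⟨t, Or.inr ⟨hp, covered_iff.1 hc x hx⟩⟩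

theorem Confirmed.subset_guarded {v e c : ℕ} {σ D : List (Option ℕ)}
    (h : Confirmed v e σ c D) : seqContent D ⊆ guarded v e σ c := by
  refine subset_guarded_iff.2 ?_
  rcases h with h | ⟨t, -, h⟩
  · exact Or.inl (seqContent_subset_iff.2 h)
  · exact Or.inr ⟨t, h⟩

/-- The bounded search in `Confirmed` loses nothing. A stage beyond `D.length` that covers `D` also
covers the challenge, whose code is at most `D.length` and whose mind change is visible by then;
hence that stage does not pass. -/
theorem Revises.not_subset_guarded {v e c : ℕ} {σ D : List (Option ℕ)}
    (h : Revises v e σ c D) : ¬ seqContent D ⊆ guarded v e σ c := by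
  obtain ⟨hτ, hch, hnc⟩ := h
  intro hsub
  rcases subset_guarded_iff.1 hsub with hs | ⟨t, hp, hc⟩
  · exact hnc (Or.inl (seqContent_subset_iff.1 hs))
  · rcases lt_or_ge t (D.length + 1) with ht | ht
    · exact hnc (Or.inr ⟨t, ht, hp, hc⟩)
    · refine hp.2 D.length.unpair.1 ((Nat.unpair_left_le _).trans_lt ht) ⟨?_, hch.mono (by omega)⟩
      exact covered_iff.2 fun x hx => covered_iff.1 hc x (seqContent_subset_iff.2 hτ hx)

section Guarded

variable {φ : ℕ → ℕ →. ℕ} {v : ℕ}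

/-- If no stage passes, nothing beyond the data of `σ` is listed; if one does, it covers `σ`. -/
theorem guarded_subset (hv : ∀ c x, x ∈ W φ c ↔ ∃ t, enumerated v c t x) (e : ℕ)
    (σ : List (Option ℕ)) (c : ℕ) :
    guarded v e σ c ⊆ seqContent σ ∨ guarded v e σ c ⊆ W φ c := by
  by_cases h : ∃ t, Passes v e σ c t
  · right
    obtain ⟨t, ht⟩ := h
    rintro x ⟨t', hx | hx⟩
    · exact (hv c x).2 ⟨t, covered_iff.1 ht.1 x hx⟩
    · exact (hv c x).2 ⟨t', hx.2⟩
  · left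
    rintro x ⟨t', hx | hx⟩
    · exact hx
    · exact (h ⟨t', hx.1⟩).elim

theorem guarded_eq_of_locking (hv : ∀ c x, x ∈ W φ c ↔ ∃ t, enumerated v c t x) {e c : ℕ}
    {σ : List (Option ℕ)} (hσ : seqContent σ ⊆ W φ c)
    (hlock : ∀ τ t, seqContent τ ⊆ W φ c → ¬ Changes e c t σ τ) : guarded v e σ c = W φ c := by
  apply Set.Subset.antisymm
  · rcases guarded_subset hv e σ c with h | h
    · exact h.trans hσ
    · exact h
  · intro x hx
    obtain ⟨t₁, h₁⟩ := (hv c x).1 hx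
    obtain ⟨t₂, h₂⟩ := exists_stage (P := fun x t => enumerated v c t x)
      (fun _ _ _ h hx => hx.mono h) σ fun y hy => (hv c y).1 (hσ hy)
    refine ⟨max t₁ t₂, Or.inr ⟨⟨covered_iff.2 fun y hy => (h₂ y hy).mono (le_max_right _ _),
      fun k _ hk => hlock (seqOfCode k) _ (fun y hy => ?_) hk.2⟩, h₁.mono (le_max_left _ _)⟩⟩
    exact (hv c y).2 ⟨_, covered_iff.1 hk.1 y hy⟩

end Guarded

/-! ### The transformed learner and its computability -/

section Learner

variable (h : List (Option ℕ) →. ℕ) (v e : ℕ)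

open Classical in
/-- The sequence with which `guarded` is used after data `D`, with the hypothesis `c` of `h`. -/
noncomputable def lockStep (s : List (Option ℕ) × ℕ) (D : List (Option ℕ)) :
    Part (List (Option ℕ) × ℕ) :=
  bif decide (Revises v e s.1 s.2 D) then
    (h (s.1 ++ challenge D ++ D)).map fun c => (s.1 ++ challenge D ++ D, c)
  else Part.some s

/-- The candidate for a locking sequence after the first `n` entries of `D`. -/
noncomputable def lockState (D : List (Option ℕ)) (n : ℕ) : Part (List (Option ℕ) × ℕ) :=
  n.rec ((h []).map fun c => ([], c)) fun i IH => IH.bind fun s => lockStep h v e s (D.take (i + 1))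

theorem partrec_lockStep (hh : Partrec h) : Partrec₂ (lockStep h v e) := by
  classical
  have h1 : Computable fun p : (List (Option ℕ) × ℕ) × List (Option ℕ) =>
      decide (Revises v e p.1.1 p.1.2 p.2) := by
    obtain ⟨_, hd⟩ := primrecPred_revises v e
    exact hd.to_comp.of_eq fun p => by congr
  have h2 : Computable fun p : (List (Option ℕ) × ℕ) × List (Option ℕ) =>
      p.1.1 ++ challenge p.2 ++ p.2 :=
    (Primrec.list_append.comp (Primrec.list_append.comp (Primrec.fst.comp Primrec.fst)
      (primrec_challenge.comp Primrec.snd)) Primrec.snd).to_comp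
  have h3 : Partrec fun p : (List (Option ℕ) × ℕ) × List (Option ℕ) =>
      (h (p.1.1 ++ challenge p.2 ++ p.2)).map fun c => (p.1.1 ++ challenge p.2 ++ p.2, c) :=
    (hh.comp h2).map ((h2.comp Computable.fst).pair Computable.snd)
  exact (Partrec.cond h1 h3 (Computable.fst.partrec)).of_eq fun p => by
    simp only [lockStep]
    congr

theorem partrec_lockState (hh : Partrec h) :
    Partrec fun D : List (Option ℕ) => lockState h v e D D.length := by
  have h0 : Partrec fun _ : List (Option ℕ) =>
      (h []).map fun c => (([], c) : List (Option ℕ) × ℕ) :=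
    (hh.comp (Computable.const [])).map
      ((Computable.const []).pair Computable.snd)
  have h1 : Partrec₂ fun (D : List (Option ℕ)) (p : ℕ × List (Option ℕ) × ℕ) =>
      lockStep h v e p.2 (D.take (p.1 + 1)) :=
    (partrec_lockStep h v e hh).comp (Computable.snd.comp Computable.snd)
      (Primrec.list_take.comp (Primrec.succ.comp (Primrec.fst.comp Primrec.snd))
        Primrec.fst).to_comp
  exact Partrec.nat_rec Computable.list_length h0 h1

end Learner

/-! ### Correctness of the transformed learner -/

section Correctness

variable {φ : ℕ → ℕ →. ℕ} {h : List (Option ℕ) →. ℕ} {v e : ℕ} {L : Set ℕ}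

/-- Every sequence of data from `L` begins some text for `L`, so the learner must be defined on it.
-/
theorem Learns.exists_mem {δ : Restriction} (hL : Learns δ h L) {σ : List (Option ℕ)}
    (hσ : seqContent σ ⊆ L) : ∃ c, c ∈ h σ := by
  obtain ⟨T, hT⟩ := exists_text L
  obtain ⟨p, hp, -⟩ := hL (T.prepend σ) (by
    rw [Text.content_prepend, hT]
    exact Set.union_eq_right.2 hσ)
  have := hp (σ.length + 0)
  rw [gold, Text.take_prepend] at this
  exact ⟨_, by simpa [Text.take] using this⟩

theorem Learns.not_ssubset (hL : Learns (CautTar φ ⊓ Ex φ) h L) {σ : List (Option ℕ)}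
    (hσ : seqContent σ ⊆ L) {c : ℕ} (hc : c ∈ h σ) : ¬ L ⊂ W φ c := by
  obtain ⟨T, hT⟩ := exists_text L
  have hT' : (T.prepend σ).content = L := by
    rw [Text.content_prepend, hT]
    exact Set.union_eq_right.2 hσ
  obtain ⟨p, hp, hd, -⟩ := hL _ hT'
  have h1 := hp (σ.length + 0)
  have h2 := hd (σ.length + 0)
  rw [gold, Text.take_prepend] at h1
  have h3 : p (σ.length + 0) = c := Part.mem_unique (by simpa [Text.take] using h1) hc
  rwa [h3, hT'] at h2

/-- A sequence on which no hypothesis change of the learner is possible determines the language. -/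
theorem Learns.W_eq_of_locking (he : ∀ σ c, c ∈ h σ ↔ ∃ t, runs e t (encode σ) = some c)
    (hL : Learns (CautTar φ ⊓ Ex φ) h L) {σ : List (Option ℕ)} (hσ : seqContent σ ⊆ L) {c : ℕ}
    (hlock : ∀ τ t, seqContent τ ⊆ L → ¬ Changes e c t σ τ) : W φ c = L := by
  obtain ⟨T, hT⟩ := exists_text L
  have hT' : (T.prepend σ).content = L := by
    rw [Text.content_prepend, hT]
    exact Set.union_eq_right.2 hσ
  obtain ⟨p, hp, -, n₀, hn⟩ := hL _ hT'
  have h1 := hp (σ.length + n₀)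
  rw [gold, Text.take_prepend] at h1
  have h2 := hn (σ.length + n₀) (by omega)
  obtain ⟨t, ht⟩ := (he _ _).1 h1
  have h3 : p (σ.length + n₀) = c := by
    by_contra hne
    exact hlock (T.take n₀) t ((T.seqContent_take_subset _).trans hT.subset)
      (changes_iff.2 ⟨_, ht, hne⟩)
  rw [← h3, h2.1, h2.2, hT']

/-- A text along a chain of sequences of unbounded length. -/
theorem exists_text_of_chain {s : ℕ → List (Option ℕ)} (hs : ∀ i j, i ≤ j → s i <+: s j)
    (hl : ∀ n, ∃ i, n < (s i).length) : ∃ T : Text, ∀ i, T.take (s i).length = s i := by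
  choose m hm using hl
  refine ⟨fun n => (s (m n))[n]'(hm n), fun i => ?_⟩
  apply List.ext_getElem (by simp [Text.take])
  intro n h1 h2
  simp only [Text.take, List.getElem_map, List.getElem_range]
  rcases le_total (m n) i with hi | hi
  · exact (hs _ _ hi).getElem _
  · exact ((hs _ _ hi).getElem _).symm

section Run

/-- `σ i` is the sequence used after `i` entries of the text `T`, if `g` computes the hypotheses of
the original learner. -/
def IsRun (v e : ℕ) (g : List (Option ℕ) → ℕ) (T : Text) (σ : ℕ → List (Option ℕ)) : Prop :=
  ∀ i, (Revises v e (σ i) (g (σ i)) (T.take (i + 1)) ∧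
      σ (i + 1) = σ i ++ challenge (T.take (i + 1)) ++ T.take (i + 1)) ∨
    (¬ Revises v e (σ i) (g (σ i)) (T.take (i + 1)) ∧ σ (i + 1) = σ i)

variable {σ : ℕ → List (Option ℕ)} {g : List (Option ℕ) → ℕ} {T : Text}

theorem isRun_prefix (hσ : IsRun v e g T σ) {i j : ℕ} (hij : i ≤ j) : σ i <+: σ j := by
  induction j, hij using Nat.le_induction with
  | base => exact List.prefix_rfl
  | succ j _ ih =>
    rcases hσ j with ⟨-, h1⟩ | ⟨-, h1⟩
    · rw [h1, List.append_assoc]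
      exact ih.trans (List.prefix_append _ _)
    · rw [h1]
      exact ih

theorem isRun_content (hσ : IsRun v e g T σ) (h0 : σ 0 = []) (i : ℕ) :
    seqContent (σ i) ⊆ T.content := by
  induction i with
  | zero => simp [h0, seqContent]
  | succ i ih =>
    rcases hσ i with ⟨h1, h2⟩ | ⟨-, h2⟩
    · rw [h2, seqContent_append, seqContent_append]
      have hT := T.seqContent_take_subset (i + 1)
      exact Set.union_subset (Set.union_subset ih ((seqContent_subset_iff.2 h1.1).trans hT)) hT
    · rw [h2]
      exact ih

/-- Once the sequence has been revised, all later hypotheses contain data outside the earlier. -/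
theorem isRun_eq_or_not_subset (hσ : IsRun v e g T σ) {i j : ℕ} (hij : i ≤ j) :
    σ i = σ j ∨ ¬ guarded v e (σ j) (g (σ j)) ⊆ guarded v e (σ i) (g (σ i)) := by
  -- The stronger claim, about the data of `σ j` instead of its guarded set, is inductive because
  -- this data only grows.
  suffices h : σ i = σ j ∨ ¬ seqContent (σ j) ⊆ guarded v e (σ i) (g (σ i)) from
    h.imp_right fun h hs => h ((seqContent_subset_guarded _ _ _ _).trans hs)
  induction j, hij using Nat.le_induction with
  | base => exact Or.inl rfl
  | succ j _ ih =>
    rcases hσ j with ⟨h1, h2⟩ | ⟨-, h2⟩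
    · right
      rw [h2, seqContent_append, seqContent_append]
      intro hs
      rcases ih with ih | ih
      · rw [ih] at hs
        exact h1.not_subset_guarded (Set.subset_union_right.trans hs)
      · exact ih ((Set.subset_union_left.trans Set.subset_union_left).trans hs)
    · rw [h2]
      exact ih

theorem isRun_conv (hσ : IsRun v e g T σ) {i : ℕ}
    (hi : seqContent (T.take (i + 1)) ⊆ guarded v e (σ i) (g (σ i))) : σ (i + 1) = σ i := by
  rcases hσ i with ⟨h1, -⟩ | ⟨-, h2⟩
  · exact (h1.not_subset_guarded hi).elim
  · exact h2

/-- Otherwise the sequences `σ i` exhaust a text `T'` for `L`, and each revision records a mind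
change of `h` along `T'`, contradicting `Ex`. -/
theorem isRun_eventually_constant (hσ : IsRun v e g T σ)
    (he : ∀ σ c, c ∈ h σ ↔ ∃ t, runs e t (encode σ) = some c)
    (hL : Learns (CautTar φ ⊓ Ex φ) h L) (hT : T.content = L)
    (h0 : σ 0 = []) (hg : ∀ i, g (σ i) ∈ h (σ i)) : ∃ n, ∀ i, n ≤ i → σ i = σ n := by
  suffices hfin : ∃ n, ∀ i, n ≤ i → ¬ Revises v e (σ i) (g (σ i)) (T.take (i + 1)) by
    obtain ⟨n, hn⟩ := hfin
    refine ⟨n, fun i hi => ?_⟩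
    induction i, hi using Nat.le_induction with
    | base => rfl
    | succ i hi ih =>
      rcases hσ i with ⟨h1, -⟩ | ⟨-, h2⟩
      · exact (hn i hi h1).elim
      · rw [h2, ih]
  by_contra! hinf
  have hrev : ∀ i, Revises v e (σ i) (g (σ i)) (T.take (i + 1)) →
      σ (i + 1) = σ i ++ challenge (T.take (i + 1)) ++ T.take (i + 1) := by
    intro i hi
    rcases hσ i with ⟨-, h2⟩ | ⟨h1, -⟩
    · exact h2
    · exact (h1 hi).elim
  have hl : ∀ n, ∃ i, n < (σ i).length := by
    intro n
    obtain ⟨i, hi, hr⟩ := hinf n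
    refine ⟨i + 1, ?_⟩
    rw [hrev i hr, List.length_append, Text.length_take]
    omega
  obtain ⟨T', hT'⟩ := exists_text_of_chain (fun i j => isRun_prefix hσ) hl
  have hcont : T'.content = L := by
    rw [← hT]
    apply Set.Subset.antisymm
    · rintro x hx
      obtain ⟨n, hn⟩ := Text.exists_mem_take hx
      obtain ⟨i, hi⟩ := hl n
      have := hn _ hi.le
      rw [hT'] at this
      exact isRun_content hσ h0 i this
    · intro x hx
      obtain ⟨n, hn⟩ := Text.exists_mem_take hx
      obtain ⟨i, hi, hr⟩ := hinf n
      -- This is why a revision appends the data seen so far, and not only the challenge.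
      have h1 : x ∈ seqContent (σ (i + 1)) := by
        rw [hrev i hr, seqContent_append]
        exact Or.inr (hn _ (by omega))
      rw [← hT'] at h1
      exact T'.seqContent_take_subset _ h1
  obtain ⟨p, hp, -, n₀, hn⟩ := hL T' hcont
  obtain ⟨m, hm⟩ := hl n₀
  obtain ⟨i, hi, hr⟩ := hinf m
  have hlen : n₀ < (σ i).length := hm.trans_le (isRun_prefix hσ hi).length_le
  have h1 : g (σ i) = p n₀ := by
    have := hp (σ i).length
    rw [gold, hT'] at this
    rw [Part.mem_unique (hg i) this, (hn _ hlen.le).1]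
  obtain ⟨c', hc', hne⟩ := changes_iff.1 hr.2.1
  refine hne ?_
  -- Both `σ i` and its extension by the challenge are initial segments of `T'`, longer than `n₀`,
  -- so `h` must agree on them.
  have h2 : T'.take (σ i ++ challenge (T.take (i + 1))).length
      = σ i ++ challenge (T.take (i + 1)) := by
    have hle : (σ i ++ challenge (T.take (i + 1))).length ≤ (σ (i + 1)).length := by
      rw [hrev i hr]
      simp only [List.length_append]
      omega
    rw [← T'.list_take_take hle, hT', hrev i hr, List.take_left']
    rfl
  have h3 := hp (σ i ++ challenge (T.take (i + 1))).length
  rw [gold, h2] at h3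
  rw [Part.mem_unique ((he _ _).2 ⟨_, hc'⟩) h3, h1]
  refine (hn _ ?_).1
  rw [List.length_append]
  omega

/-- If a mind change on data of `L` exists, the absence of further revisions means that ever larger
data is confirmed, so `L` lies in the guarded set and target-caution gives equality. Otherwise `σ n`
is locking. -/
theorem isRun_guarded_eq (hσ : IsRun v e g T σ)
    (hv : ∀ c x, x ∈ W φ c ↔ ∃ t, enumerated v c t x)
    (he : ∀ σ c, c ∈ h σ ↔ ∃ t, runs e t (encode σ) = some c)
    (hL : Learns (CautTar φ ⊓ Ex φ) h L) (hT : T.content = L)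
    (h0 : σ 0 = []) (hg : ∀ i, g (σ i) ∈ h (σ i)) {n : ℕ} (hn : ∀ i, n ≤ i → σ i = σ n) :
    guarded v e (σ n) (g (σ n)) = L := by
  have hsub : seqContent (σ n) ⊆ L := hT ▸ isRun_content hσ h0 n
  by_cases hch : ∃ τ t, seqContent τ ⊆ L ∧ Changes e (g (σ n)) t (σ n) τ
  · obtain ⟨τ, t, hτ, hch⟩ := hch
    have hLsub : L ⊆ guarded v e (σ n) (g (σ n)) := by
      intro x hx
      rw [← hT] at hx
      obtain ⟨m₁, h₁⟩ := Text.exists_mem_take hx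
      obtain ⟨m₂, h₂⟩ := exists_stage (P := fun x i => x ∈ seqContent (T.take i))
        (fun _ _ _ h hx => T.seqContent_take_mono h hx) τ fun y hy => by
          obtain ⟨k, hk⟩ := Text.exists_mem_take (T := T) (x := y) (by rw [hT]; exact hτ hy)
          exact ⟨k, hk k le_rfl⟩
      -- At this length the challenge is `τ`; the large second component puts the position past
      -- every threshold.
      obtain ⟨i, hi⟩ : ∃ i, i + 1 = Nat.pair (encode τ) (m₁ + m₂ + t + n + 1) := by
        refine ⟨Nat.pair (encode τ) (m₁ + m₂ + t + n + 1) - 1, ?_⟩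
        have := Nat.right_le_pair (encode τ) (m₁ + m₂ + t + n + 1)
        omega
      have hle := Nat.right_le_pair (encode τ) (m₁ + m₂ + t + n + 1)
      have hchal : challenge (T.take (i + 1)) = τ := by
        rw [challenge, Text.length_take, hi, Nat.unpair_pair, seqOfCode_encode]
      have hx' := h₁ (i + 1) (by omega)
      rcases hσ i with ⟨h1, -⟩ | ⟨h1, -⟩
      · have h2 := hn (i + 1) (by omega)
        have h3 := isRun_eq_or_not_subset hσ (Nat.le_succ i)
        rcases hσ i with ⟨-, h4⟩ | ⟨h4, -⟩
        -- A revision would lengthen `σ` by at least `i + 1` entries after it has settled.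
        · rw [h2, hn i (by omega)] at h4
          have := congrArg List.length h4
          simp only [List.length_append, Text.length_take] at this
          omega
        · exact (h4 h1).elim
      · rw [hn i (by omega)] at h1
        have hconf : Confirmed v e (σ n) (g (σ n)) (T.take (i + 1)) := by
          by_contra hc
          refine h1 ⟨?_, ?_, hc⟩
          · rw [hchal]
            refine seqContent_subset_iff.1 fun y hy => ?_
            exact T.seqContent_take_mono (by omega) (h₂ y hy)
          · rw [hchal, Text.length_take]
            exact hch.mono (by omega)
        exact hconf.subset_guarded hx'
    refine Set.Subset.antisymm ?_ hLsub
    rcases guarded_subset hv e (σ n) (g (σ n)) with h1 | h1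
    · exact h1.trans hsub
    · by_contra hne
      exact hL.not_ssubset hsub (hg n)
        ⟨hLsub.trans h1, fun h2 => hne (h1.trans h2)⟩
  · push Not at hch
    have hW := hL.W_eq_of_locking he hsub (c := g (σ n)) fun τ t hτ => hch τ t hτ
    rw [guarded_eq_of_locking hv (by rwa [hW]) fun τ t hτ => hch τ t (by rwa [hW] at hτ), hW]

end Run

end Correctness

/-- A target-cautious learner can be replaced by a conservative, cautious and strongly decisive
one. -/
theorem TxtG_cautTar_subset {φ : ℕ → ℕ →. ℕ} (hφ : IsAcceptable φ) :
    TxtG (CautTar φ ⊓ Ex φ) ⊆ TxtG (Conv φ ⊓ Caut φ ⊓ SDec φ ⊓ Ex φ) := by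
  classical
  rintro 𝓛 ⟨hre, h, hh, hlearn⟩
  obtain ⟨v, hv⟩ := hφ.exists_enumerated
  obtain ⟨e, he⟩ := exists_index hh
  obtain ⟨q, hq, hqW⟩ := hφ.exists_program (α := List (Option ℕ) × ℕ)
    (R := fun s x t => some x ∈ s.1 ∨ (Passes v e s.1 s.2 t ∧ enumerated v s.2 t x)) (by
      have hmem : PrimrecPred fun p : ((List (Option ℕ) × ℕ) × ℕ) × ℕ =>
          some p.1.2 ∈ p.1.1.1 := by
        have := (Primrec.eq (α := Option ℕ)).exists_mem_list
        exact (this.comp (Primrec.fst.comp (Primrec.fst.comp Primrec.fst))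
          (Primrec.option_some.comp (Primrec.snd.comp Primrec.fst))).of_eq fun p => by simp
      have hc : Primrec fun p : ((List (Option ℕ) × ℕ) × ℕ) × ℕ => p.1.1.2 :=
        Primrec.snd.comp (Primrec.fst.comp Primrec.fst)
      exact hmem.or ((primrecPred_passes v e (Primrec.fst.comp (Primrec.fst.comp Primrec.fst)) hc
        Primrec.snd).and (primrec_enumerated v hc Primrec.snd (Primrec.snd.comp Primrec.fst))))
  have hqW' : ∀ s : List (Option ℕ) × ℕ, W φ (q s) = guarded v e s.1 s.2 := hqW
  refine ⟨hre, fun D => (lockState h v e D D.length).map q,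
    (partrec_lockState h v e hh).map (hq.comp Computable.snd), fun L hL T hT => ?_⟩
  have hl := hlearn L hL
  -- The default value is harmless: along the run `h` is queried only on data of the target, where
  -- it is defined.
  let g : List (Option ℕ) → ℕ := fun τ => if hτ : (h τ).Dom then (h τ).get hτ else 0
  have hg : ∀ τ, seqContent τ ⊆ L → g τ ∈ h τ := by
    intro τ hτ
    obtain ⟨c, hc⟩ := hl.exists_mem hτ
    have hd : (h τ).Dom := Part.dom_iff_mem.2 ⟨c, hc⟩
    simp only [g, dif_pos hd]
    exact Part.get_mem hd
  let σ : ℕ → List (Option ℕ) := fun n => n.rec [] fun i τ =>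
    if Revises v e τ (g τ) (T.take (i + 1)) then τ ++ challenge (T.take (i + 1)) ++ T.take (i + 1)
    else τ
  have h0 : σ 0 = [] := rfl
  have hσ : IsRun v e g T σ := by
    intro i
    by_cases hr : Revises v e (σ i) (g (σ i)) (T.take (i + 1))
    · exact Or.inl ⟨hr, if_pos hr⟩
    · exact Or.inr ⟨hr, if_neg hr⟩
  have hgσ : ∀ i, g (σ i) ∈ h (σ i) := fun i => hg _ (hT ▸ isRun_content hσ h0 i)
  have hstate : ∀ i n, i ≤ n → (σ i, g (σ i)) ∈ lockState h v e (T.take n) i := by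
    intro i n hin
    induction i with
    | zero => exact Part.mem_map _ (hgσ 0)
    | succ i ih =>
      refine Part.mem_bind (ih (by omega)) ?_
      simp only [lockStep, Text.list_take_take T hin]
      rcases hσ i with ⟨h1, h2⟩ | ⟨h1, h2⟩
      · simp only [h1, decide_true, cond_true]
        rw [← h2]
        exact Part.mem_map _ (hgσ (i + 1))
      · simp only [h1, decide_false, cond_false]
        rw [h2]
        exact Part.mem_some _
  refine ⟨fun i => q (σ i, g (σ i)), fun i => ?_, ⟨⟨?_, ?_⟩, ?_⟩, ?_⟩
  · have := hstate i i le_rfl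
    simp only [gold, Text.length_take]
    exact Part.mem_map _ this
  · intro i hi
    simp only [hqW'] at hi
    simp only [isRun_conv hσ hi]
  · intro i j hij
    simp only [hqW'] at hij
    by_contra hji
    rcases isRun_eq_or_not_subset hσ (not_lt.1 hji) with h1 | h1
    · rw [h1] at hij
      exact hij.ne rfl
    · exact h1 hij.subset
  · intro i j k hij hjk hik
    simp only [hqW'] at hik
    have h1 : σ i = σ k :=
      (isRun_eq_or_not_subset hσ (hij.trans hjk)).resolve_right fun h => h hik.symm.subset
    -- `σ j` lies between `σ i` and `σ k` in the prefix order.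
    have h2 : σ i = σ j := (isRun_prefix hσ hij).eq_of_length_le
      (by rw [h1]; exact (isRun_prefix hσ hjk).length_le)
    simp only [h2]
  · obtain ⟨n, hn⟩ := isRun_eventually_constant hσ he hl hT h0 hgσ
    refine ⟨n, fun i hi => ⟨by simp only [hn i hi], ?_⟩⟩
    simp only [hqW']
    rw [hT]
    exact isRun_guarded_eq hσ hv he hl hT h0 hgσ hn

theorem TxtG_caut_eq_conv {φ : ℕ → ℕ →. ℕ} (hφ : IsAcceptable φ) :
    TxtG (Caut φ ⊓ Ex φ) = TxtG (Conv φ ⊓ Ex φ) := by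
  apply Set.Subset.antisymm
  · refine (TxtG_mono fun p T hp => ?_).trans
      ((TxtG_cautTar_subset hφ).trans (TxtG_mono fun p T hp => ⟨hp.1.1.1, hp.2⟩))
    exact ⟨hp.1.cautTar hp.2, hp.2⟩
  · refine (TxtG_mono fun p T hp => ?_).trans
      ((TxtG_cautTar_subset hφ).trans (TxtG_mono fun p T hp => ⟨hp.1.1.2, hp.2⟩))
    exact ⟨hp.1.cautTar hp.2, hp.2⟩

theorem TxtG_caut_subset_sDec {φ : ℕ → ℕ →. ℕ} (hφ : IsAcceptable φ) :
    TxtG (Caut φ ⊓ Ex φ) ⊆ TxtG (SDec φ ⊓ Ex φ) := by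
  refine (TxtG_mono fun p T hp => ?_).trans
    ((TxtG_cautTar_subset hφ).trans (TxtG_mono fun p T hp => ⟨hp.1.2, hp.2⟩))
  exact ⟨hp.1.cautTar hp.2, hp.2⟩

/-! ### A class that cannot be learned cautiously -/

/-- The sequence `⟨e, 0⟩, …, ⟨e, n⟩`. -/
def row (e n : ℕ) : List (Option ℕ) := (List.range (n + 1)).map fun x => some (Nat.pair e x)

/-- The pair `k = ⟨n, t⟩` witnesses that within `t` steps program `e` conjectures, on the data
`⟨e, 0⟩, …, ⟨e, n⟩`, a set in which all of `⟨e, 0⟩, …, ⟨e, n + 1⟩` is listed. -/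
def Overshoots (v e k : ℕ) : Prop :=
  (runs e k.unpair.2 (encode (row e k.unpair.1))).isSome = true ∧
    Covered v ((runs e k.unpair.2 (encode (row e k.unpair.1))).getD 0) k.unpair.2
      (row e (k.unpair.1 + 1))

/-- The data `⟨e, x⟩` for `x` up to one more than the first witness (all `x` if there is none). -/
def openRow (v e : ℕ) : Set ℕ :=
  {y | y.unpair.1 = e ∧ ∀ k < y.unpair.2 - 1, ¬ Overshoots v e k}

/-- The data `⟨e, 0⟩, …, ⟨e, n⟩`. -/
def closedRow (e n : ℕ) : Set ℕ := {y | y.unpair.1 = e ∧ y.unpair.2 ≤ n}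

/-- The class of all `openRow v e` without witness and all `closedRow e n`, where `⟨n, t⟩` is the
least witness. -/
def rowClass (v : ℕ) : Set (Set ℕ) :=
  {L | ∃ e, ((∀ k, ¬ Overshoots v e k) ∧ L = openRow v e) ∨
    ∃ k, Overshoots v e k ∧ (∀ j < k, ¬ Overshoots v e j) ∧ L = closedRow e k.unpair.1}

theorem primrec_row {α : Type*} [Primcodable α] {f g : α → ℕ} (hf : Primrec f) (hg : Primrec g) :
    Primrec fun a => row (f a) (g a) :=
  Primrec.list_map (Primrec.list_range.comp (Primrec.succ.comp hg))
    (Primrec.option_some.comp (Primrec₂.natPair.comp (hf.comp Primrec.fst) Primrec.snd))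

theorem primrecRel_overshoots (v : ℕ) : PrimrecRel (Overshoots v) := by
  have h1 : Primrec fun p : ℕ × ℕ => p.2.unpair.1 :=
    Primrec.fst.comp (Primrec.unpair.comp Primrec.snd)
  have h2 : Primrec fun p : ℕ × ℕ => p.2.unpair.2 :=
    Primrec.snd.comp (Primrec.unpair.comp Primrec.snd)
  have hr := primrec_runs Primrec.fst h2 (Primrec.encode.comp (primrec_row Primrec.fst h1))
  exact (Primrec.eq.comp (Primrec.option_isSome.comp hr) (Primrec.const true)).and
    (primrecPred_covered v (Primrec.option_getD.comp hr (Primrec.const 0)) h2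
      (primrec_row Primrec.fst (Primrec.succ.comp h1)))

theorem seqContent_row (e n : ℕ) : seqContent (row e n) = closedRow e n := by
  ext y
  simp only [seqContent, row, Set.mem_ofPred_eq, List.mem_map, List.mem_range, closedRow,
    Option.some.injEq]
  constructor
  · rintro ⟨x, hx, rfl⟩
    simp
    omega
  · rintro ⟨rfl, h⟩
    exact ⟨y.unpair.2, by omega, Nat.pair_unpair y⟩

theorem openRow_eq {v e : ℕ} (h : ∀ k, ¬ Overshoots v e k) : openRow v e = {y | y.unpair.1 = e} := by
  ext y
  simp [openRow, h]

/-- Entries of `openRow` up to `k + 1` are present, and `k.unpair.1 ≤ k`. The shift by one in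
`openRow` makes the inclusion proper, so that passing from the open to the closed row changes the
set. -/
theorem closedRow_ssubset_openRow {v e k : ℕ} (hk : ∀ j < k, ¬ Overshoots v e j) :
    closedRow e k.unpair.1 ⊂ openRow v e := by
  have hle := Nat.unpair_left_le k
  refine ⟨fun y hy => ⟨hy.1, fun j hj => hk j ?_⟩, fun h => ?_⟩
  · have := hy.2
    omega
  · have h1 : Nat.pair e (k.unpair.1 + 1) ∈ openRow v e :=
      ⟨by simp, fun j hj => hk j (by simp at hj; omega)⟩
    have h2 := (h h1).2
    simp at h2

/-- For `e` a program of the learner, a witness exhibits a proper superset of the target conjectured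
on data of the target. Without a witness the target is the full row, and convergence on it would
itself produce a witness. -/
theorem rowClass_not_caut {φ : ℕ → ℕ →. ℕ} {v : ℕ}
    (hv : ∀ c x, x ∈ W φ c ↔ ∃ t, enumerated v c t x) :
    rowClass v ∉ TxtG (Caut φ ⊓ Ex φ) := by
  rintro ⟨-, h, hh, hlearn⟩
  obtain ⟨e, he⟩ := exists_index hh
  by_cases hex : ∃ k, Overshoots v e k
  · classical
    obtain ⟨k, hk, hmin⟩ : ∃ k, Overshoots v e k ∧ ∀ j < k, ¬ Overshoots v e j :=
      ⟨Nat.find hex, Nat.find_spec hex, fun j hj => Nat.find_min hex hj⟩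
    have hl : Learns (CautTar φ ⊓ Ex φ) h (closedRow e k.unpair.1) :=
      (hlearn _ ⟨e, Or.inr ⟨k, hk, hmin, rfl⟩⟩).mono fun p T hp => ⟨hp.1.cautTar hp.2, hp.2⟩
    obtain ⟨hsome, henum⟩ := hk
    obtain ⟨c, hc⟩ := Option.isSome_iff_exists.1 hsome
    rw [hc] at henum
    have hsub : closedRow e (k.unpair.1 + 1) ⊆ W φ c := fun x hx =>
      (hv c x).2 ⟨_, covered_iff.1 henum x (by rwa [seqContent_row])⟩
    refine hl.not_ssubset (seqContent_row e _).subset ((he _ _).2 ⟨_, hc⟩)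
      ⟨fun x hx => hsub ⟨hx.1, hx.2.trans (Nat.le_succ _)⟩, fun h => ?_⟩
    have h1 : Nat.pair e (k.unpair.1 + 1) ∈ closedRow e k.unpair.1 :=
      h (hsub ⟨by simp, by simp⟩)
    simp [closedRow] at h1
  · push Not at hex
    let T : Text := fun x => some (Nat.pair e x)
    have hT : T.content = openRow v e := by
      rw [openRow_eq hex]
      ext y
      simp only [Text.content, T, Set.mem_ofPred_eq, Option.some.injEq]
      constructor
      · rintro ⟨i, rfl⟩
        simp
      · rintro rfl
        exact ⟨y.unpair.2, Nat.pair_unpair y⟩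
    obtain ⟨p, hp, -, n₀, hn⟩ := hlearn _ ⟨e, Or.inl ⟨hex, rfl⟩⟩ T hT
    have h1 := hn (n₀ + 1) (by omega)
    obtain ⟨t₁, ht₁⟩ := (he _ _).1 (hp (n₀ + 1))
    obtain ⟨t₂, ht₂⟩ := exists_stage (P := fun x t => enumerated v (p (n₀ + 1)) t x)
      (fun _ _ _ h hx => hx.mono h) (row e (n₀ + 1)) fun x hx => by
        rw [← hv, h1.1, h1.2]
        rw [seqContent_row] at hx
        exact hT ▸ (openRow_eq hex ▸ hx.1 : x ∈ openRow v e)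
    -- The first `n₀ + 1` entries of `T` are exactly `row e n₀`.
    have h3 : runs e (max t₁ t₂) (encode (row e n₀)) = some (p (n₀ + 1)) :=
      runs_mono (le_max_left _ _) ht₁
    refine hex (Nat.pair n₀ (max t₁ t₂)) ?_
    simp only [Overshoots, Nat.unpair_pair, h3]
    exact ⟨rfl, covered_iff.2 fun x hx => (ht₂ x hx).mono (le_max_right _ _)⟩

/-- A sequence of hypotheses that passes through at most three stages, the first of them empty and
the last of them correct, with pairwise different sets. -/
theorem sDec_mon_ex_of_stages {φ : ℕ → ℕ →. ℕ} {p P a : ℕ → ℕ} {T : Text} {m n : ℕ}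
    (hp : ∀ i, p i = P (a i)) (ha : Monotone a) (hm : m ≤ 2) (ham : ∀ i, a i ≤ m) (hn : a n = m)
    (h0 : W φ (P 0) = ∅) (hlast : W φ (P m) = T.content)
    (hne : ∀ i j, i < j → j ≤ m → W φ (P i) ≠ W φ (P j)) :
    (SDec φ ⊓ Mon φ ⊓ Ex φ) p T := by
  refine ⟨⟨fun i j k hij hjk hik => ?_, fun i j hij => ?_⟩, n, fun i hi => ?_⟩
  · rw [hp, hp] at hik
    have hak : a i = a k := by
      by_contra hlt
      exact hne _ _ (lt_of_le_of_ne (ha (hij.trans hjk)) hlt) (ham k) hik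
    rw [hp, hp, le_antisymm (hak ▸ ha hjk) (ha hij)]
  · rw [hp, hp]
    rcases (ha hij.le).eq_or_lt with h | h
    · rw [h]
    · rcases (ham j).eq_or_lt with hj | hj
      · rw [hj, hlast, Set.inter_self]
        exact Set.inter_subset_right
      -- As `m ≤ 2`, two different stages before the last can only be 0 and 1.
      · have : a i = 0 := by omega
        rw [this, h0, Set.empty_inter]
        exact Set.empty_subset _
  · have hai : a i = m := le_antisymm (ham i) (hn ▸ ha hi)
    rw [hp, hp, hn, hai]
    exact ⟨rfl, hlast⟩

open Classical in
/-- What is known about the target from the data `D`: the row `e`, and the least witness, as far as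
they have been found. -/
noncomputable def rowInfo (v : ℕ) (D : List (Option ℕ)) : Option (ℕ × Option ℕ) :=
  (D.filterMap id).head?.map fun y => (y.unpair.1,
    ((List.range D.length).filter fun k => decide (Overshoots v y.unpair.1 k)).head?)

/-- The hypothesis for the information `d`. -/
def RowHyp (v : ℕ) (d : Option (ℕ × Option ℕ)) (y : ℕ) : Prop :=
  d ≠ none ∧ y.unpair.1 = (d.getD (0, none)).1 ∧
    (((d.getD (0, none)).2 = none ∧
      ∀ k < y.unpair.2 - 1, ¬ Overshoots v (d.getD (0, none)).1 k) ∨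
    ((d.getD (0, none)).2 ≠ none ∧ y.unpair.2 ≤ ((d.getD (0, none)).2.getD 0).unpair.1))

theorem primrec_rowInfo (v : ℕ) : Primrec (rowInfo v) := by
  classical
  refine Primrec.option_map (Primrec.list_head?.comp
    (Primrec.listFilterMap Primrec.id Primrec.snd)) ?_
  have he : Primrec fun p : List (Option ℕ) × ℕ => p.2.unpair.1 :=
    Primrec.fst.comp (Primrec.unpair.comp Primrec.snd)
  have hf := (primrecRel_overshoots v).swap.listFilter.comp
    (Primrec.list_range.comp (Primrec.list_length.comp Primrec.fst)) he
  refine he.pair (Primrec.list_head?.comp (hf.of_eq fun p => ?_))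
  rfl

theorem primrecPred_rowHyp (v : ℕ) :
    PrimrecPred fun p : (Option (ℕ × Option ℕ) × ℕ) × ℕ => RowHyp v p.1.1 p.1.2 := by
  have hd : Primrec fun p : (Option (ℕ × Option ℕ) × ℕ) × ℕ => p.1.1 :=
    Primrec.fst.comp Primrec.fst
  have hi : Primrec fun p : (Option (ℕ × Option ℕ) × ℕ) × ℕ => p.1.1.getD (0, none) :=
    Primrec.option_getD.comp hd (Primrec.const (0, none))
  have hy := Primrec.unpair.comp (Primrec.snd.comp
    (Primrec.fst (α := Option (ℕ × Option ℕ) × ℕ) (β := ℕ)))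
  have hnone := Primrec.eq.comp (Primrec.snd.comp hi) (Primrec.const none)
  refine (Primrec.eq.comp hd (Primrec.const none)).not.and
    ((Primrec.eq.comp (Primrec.fst.comp hy) (Primrec.fst.comp hi)).and
      ((hnone.and ?_).or (hnone.not.and ?_)))
  · exact primrecPred_forall_lt (primrecRel_overshoots v).swap.not
      (Primrec.nat_sub.comp (Primrec.snd.comp hy) (Primrec.const 1)) (Primrec.fst.comp hi)
  · exact Primrec.nat_le.comp (Primrec.snd.comp hy) (Primrec.fst.comp (Primrec.unpair.comp
      (Primrec.option_getD.comp (Primrec.snd.comp hi) (Primrec.const 0))))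

theorem rowInfo_eq_none {v : ℕ} {D : List (Option ℕ)} (hD : seqContent D = ∅) :
    rowInfo v D = none := by
  have : D.filterMap id = [] := by
    rw [List.filterMap_eq_nil_iff]
    intro o ho
    cases o with
    | none => rfl
    | some x => exact (Set.eq_empty_iff_forall_notMem.1 hD x ho).elim
  rw [rowInfo, this]
  rfl

theorem exists_rowInfo_eq {v e : ℕ} {D : List (Option ℕ)} (hD : seqContent D ≠ ∅)
    (he : ∀ y ∈ seqContent D, y.unpair.1 = e) : ∃ o, rowInfo v D = some (e, o) ∧
      ((∀ k < D.length, ¬ Overshoots v e k) → o = none) ∧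
      ∀ k < D.length, Overshoots v e k → (∀ j < k, ¬ Overshoots v e j) → o = some k := by
  classical
  have hne : D.filterMap id ≠ [] := by
    intro h
    rw [List.filterMap_eq_nil_iff] at h
    exact hD (Set.eq_empty_iff_forall_notMem.2 fun x hx => by simpa using h _ hx)
  obtain ⟨y, l, hl⟩ := List.exists_cons_of_ne_nil hne
  have hy : y ∈ seqContent D := by
    have : y ∈ D.filterMap id := hl ▸ List.mem_cons_self
    simpa [seqContent] using this
  refine ⟨_, by simp only [rowInfo, hl, List.head?_cons, Option.map_some, he y hy]; rfl, ?_, ?_⟩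
  · intro h
    rw [List.head?_eq_none_iff, List.filter_eq_nil_iff]
    intro k hk
    simpa using h k (List.mem_range.1 hk)
  · intro k hk hov hmin
    rw [List.head?_filter, List.find?_range_eq_some]
    simpa [hov, hk] using hmin

theorem rowClass_sDec_mon {φ : ℕ → ℕ →. ℕ} (hφ : IsAcceptable φ) (v : ℕ) :
    rowClass v ∈ TxtG (SDec φ ⊓ Mon φ ⊓ Ex φ) := by
  classical
  -- Membership in these hypotheses is decidable, so the enumeration stage plays no role.
  obtain ⟨q, hq, hqW⟩ := hφ.exists_program (R := fun d y _ => RowHyp v d y)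
    (primrecPred_rowHyp v)
  have hq0 : W φ (q none) = ∅ := by
    rw [hqW]
    ext y
    simp [RowHyp]
  have hq1 : ∀ e, W φ (q (some (e, none))) = openRow v e := by
    intro e
    rw [hqW]
    ext y
    simp [RowHyp, openRow]
  have hq2 : ∀ e k, W φ (q (some (e, some k))) = closedRow e k.unpair.1 := by
    intro e k
    rw [hqW]
    ext y
    simp [RowHyp, closedRow]
  have hopen : ∀ e, openRow v e ≠ ∅ := fun e =>
    Set.Nonempty.ne_empty ⟨Nat.pair e 0, by simp, by simp⟩
  have hclosed : ∀ e n, closedRow e n ≠ ∅ := fun e n =>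
    Set.Nonempty.ne_empty ⟨Nat.pair e 0, by simp, by simp⟩
  have hlearn : ∀ L ∈ rowClass v, Learns (SDec φ ⊓ Mon φ ⊓ Ex φ)
      (fun D => Part.some (q (rowInfo v D))) L := by
    rintro L ⟨e, ⟨hno, rfl⟩ | ⟨k, hk, hmin, rfl⟩⟩ T hT
    · have hrow : ∀ i, ∀ y ∈ seqContent (T.take i), y.unpair.1 = e := fun i y hy =>
        (hT ▸ T.seqContent_take_subset i hy : y ∈ openRow v e).1
      obtain ⟨n, hn⟩ := Text.exists_mem_take (T := T) (x := Nat.pair e 0)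
        (by rw [hT]; exact ⟨by simp, by simp⟩)
      refine ⟨fun i => q (rowInfo v (T.take i)), fun i => Part.mem_some _,
        sDec_mon_ex_of_stages (m := 1) (n := n)
          (P := fun b => q (if b = 0 then none else some (e, none)))
          (a := fun i => if seqContent (T.take i) = ∅ then 0 else 1)
          (fun i => ?_) (fun i j hij => ?_) (by norm_num) (fun i => ?_) ?_ ?_ ?_ ?_⟩
      · by_cases h : seqContent (T.take i) = ∅
        · simp [h, rowInfo_eq_none h]
        · obtain ⟨o, ho, h1, -⟩ := exists_rowInfo_eq (v := v) h (hrow i)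
          simp [h, ho, h1 fun k _ => hno k]
      · have := T.seqContent_take_mono hij
        by_cases h : seqContent (T.take j) = ∅
        · simp [h, Set.subset_eq_empty this h]
        · simp only [h, if_false]
          split_ifs <;> simp
      · split_ifs <;> simp
      · simp [Set.Nonempty.ne_empty ⟨_, hn n le_rfl⟩]
      · simpa using hq0
      · simpa [hT] using hq1 e
      · intro i j hij hj
        obtain rfl : j = 1 := by omega
        obtain rfl : i = 0 := by omega
        simpa [hq0, hq1] using (hopen e).symm
    · have hrow : ∀ i, ∀ y ∈ seqContent (T.take i), y.unpair.1 = e := fun i y hy =>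
        (hT ▸ T.seqContent_take_subset i hy : y ∈ closedRow e k.unpair.1).1
      obtain ⟨n, hn⟩ := Text.exists_mem_take (T := T) (x := Nat.pair e 0)
        (by rw [hT]; exact ⟨by simp, by simp⟩)
      refine ⟨fun i => q (rowInfo v (T.take i)), fun i => Part.mem_some _,
        sDec_mon_ex_of_stages (m := 2) (n := n + k + 1)
          (P := fun b => q (if b = 0 then none else if b = 1 then some (e, none)
            else some (e, some k)))
          -- The search covers numbers below the length of the data, so the witness `k` is seen
          -- exactly when `i > k`.
          (a := fun i => if seqContent (T.take i) = ∅ then 0 else if i ≤ k then 1 else 2)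
          (fun i => ?_) (fun i j hij => ?_) (by norm_num) (fun i => ?_) ?_ ?_ ?_ ?_⟩
      · by_cases h : seqContent (T.take i) = ∅
        · simp [h, rowInfo_eq_none h]
        · obtain ⟨o, ho, h1, h2⟩ := exists_rowInfo_eq (v := v) h (hrow i)
          rw [Text.length_take] at h1 h2
          by_cases hi : i ≤ k
          · simp [h, ho, hi, h1 fun j hj => hmin j (by omega)]
          · simp [h, ho, hi, h2 k (by omega) hk hmin]
      · have := T.seqContent_take_mono hij
        by_cases h : seqContent (T.take j) = ∅
        · simp [h, Set.subset_eq_empty this h]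
        · simp only [h, if_false]
          by_cases hj : j ≤ k
          · simp only [hj, hij.trans hj, if_true]
            split_ifs <;> simp
          · simp only [hj, if_false]
            split_ifs <;> simp
      · split_ifs <;> simp
      · have h1 : ¬ n + k + 1 ≤ k := by omega
        simp [Set.Nonempty.ne_empty ⟨_, hn (n + k + 1) (by omega)⟩, h1]
      · simpa using hq0
      · simpa [hT] using hq2 e k
      · intro i j hij hj
        obtain ⟨rfl, rfl⟩ | ⟨rfl, rfl⟩ | ⟨rfl, rfl⟩ :
            (i = 0 ∧ j = 1) ∨ (i = 0 ∧ j = 2) ∨ (i = 1 ∧ j = 2) := by omega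
        · simpa [hq0, hq1] using (hopen e).symm
        · simpa [hq0, hq2] using (hclosed e k.unpair.1).symm
        · simpa [hq1, hq2] using (closedRow_ssubset_openRow hmin).ne'
  exact ⟨fun L hL => (hlearn L hL).rePred hφ fun p T hp => hp.2, _,
    (hq.comp (primrec_rowInfo v).to_comp).partrec, hlearn⟩

end TxtLearning

theorem mainTheorem11 (φ : ℕ → ℕ →. ℕ) (hφ : IsAcceptable φ) :
    (∃ 𝓛 : Set (Set ℕ),
      𝓛 ∈ TxtG (SDec φ ⊓ Mon φ ⊓ Ex φ) ∧ 𝓛 ∉ TxtG (Caut φ ⊓ Ex φ)) ∧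
    TxtG (Caut φ ⊓ Ex φ) = TxtG (Conv φ ⊓ Ex φ) ∧
    TxtG (Caut φ ⊓ Ex φ) ⊂ TxtG (SDec φ ⊓ Ex φ) := by
  obtain ⟨v, hv⟩ := hφ.exists_enumerated
  have hpos := rowClass_sDec_mon hφ v
  have hneg := rowClass_not_caut hv
  refine ⟨⟨rowClass v, hpos, hneg⟩, TxtG_caut_eq_conv hφ, TxtG_caut_subset_sDec hφ, fun h => ?_⟩
  -- Equality would make `rowClass v` cautiously learnable, since it is strongly decisively
  -- learnable.
  exact hneg (h (TxtG_mono (fun p T hp => ⟨hp.1.1, hp.2⟩) hpos))
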